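/- Let $k$ be an infinite integral domain, $m,n\ge 0$, $B=k[b_1,\dots,b_m]$, and let $\pi:\mathbb{A}^n_B=\operatorname{Spec} B[x_1,\dots,x_n]\to\operatorname{Spec} B$ be the projection. For a closed subset $Z\subseteq\mathbb{A}^n_B$ we say that the fibres of $Z$ along $\pi$ are generically $e$-dimensional if there is an open $U\subseteq\operatorname{Spec}B$ such that $U\cap\overline{\pi(Z)}$ is dense in $\overline{\pi(Z)}$ and $\dim\bigl(Z\cap\pi^{-1}(p)\bigr)=e$ (Krull dimension) for all $p\in U\cap\overline{\pi(Z)}$. Over a ring $S$, an affine subspace of $\mathbb{A}^n_S$ of dimension $e$ is a closed subset $V(Ax-c)$ with $c\in S^{n-e}$ and $A\in S^{(n-e)\times n}$ a matrix whose rows form part of a basis of $S^n$. Let $\Gamma\subseteq\mathbb{A}^n_B$ be a nonempty irreducible closed subset whose fibres along $\pi$ are generically $d$-dimensional, and let $I\lhd B[x_1,\dots,x_n]$ be its vanishing ideal. Assume $k\cap I=\langle 0\rangle$. Then for every integer $0\le d'\le d$ there is an affine subspace $L'\subseteq\mathbb{A}^n_k$ of dimension $n-d'$ such that $L:=L'\times_k\operatorname{Spec}B\subseteq\mathbb{A}^n_B$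 is an affine subspace of dimension $n-d'$ over $B$, and $\Gamma_0:=\Gamma\cap L$ satisfies 1. the fibres of $\Gamma_0$ along $\pi$ are generically $(d-d')$-dimensional; 2. $\overline{\pi(\Gamma_0)}=\overline{\pi(\Gamma)}$. Moreover, $L'$ can be chosen generically: there is a polynomial $q$ over $k$ in the $d'n+d'$ entries of a matrix $A\in k^{d'\times n}$ and a vector $c\in k^{d'}$ such that $q(A,c)\neq 0$ for at least one pair $(A,c)$ for which $V(Ax-c)$ is an affine subspace of dimension $n-d'$ in the above sense, and such that for all $(A,c)$ with $q(A,c)\ne 0$ the rows of $A$ are linearly independent over $k$ and 1. and 2. hold for $L'=V(Ax-c)$. -/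

import Mathlib

/-- The coordinate ring `B = k[b_1, …, b_m]` of the base. -/
abbrev BaseRing (k : Type*) [CommRing k] (m : ℕ) : Type _ := MvPolynomial (Fin m) k

/-- The coordinate ring `B[x_1, …, x_n]` of the relative affine space `𝔸ⁿ_B`. -/
abbrev TotalRing (k : Type*) [CommRing k] (m n : ℕ) : Type _ :=
  MvPolynomial (Fin n) (BaseRing k m)

/-- The affine space `𝔸ⁿ_S = Spec S[x_1, …, x_n]` over a ring `S`. -/
abbrev RelAffineSpace (S : Type*) [CommRing S] (n : ℕ) : Type _ :=
  PrimeSpectrum (MvPolynomial (Fin n) S)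

/-- The base projection `π : 𝔸ⁿ_B → Spec B`, sending a prime `P` to `P ∩ B`. -/
noncomputable def baseProj (k : Type*) [CommRing k] (m n : ℕ) :
    RelAffineSpace (BaseRing k m) n → PrimeSpectrum (BaseRing k m) :=
  PrimeSpectrum.comap (MvPolynomial.C : BaseRing k m →+* TotalRing k m n)

/-- The first projection `𝔸ⁿ_B = 𝔸ⁿ_k ×_k Spec B → 𝔸ⁿ_k`, sending a prime `P`
to `P ∩ k[x_1, …, x_n]`. -/
noncomputable def coordProj (k : Type*) [CommRing k] (m n : ℕ) :
    RelAffineSpace (BaseRing k m) n → RelAffineSpace k n :=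
  PrimeSpectrum.comap (MvPolynomial.map (MvPolynomial.C : k →+* BaseRing k m))

/-- The subset `L' ×_k Spec B` of `𝔸ⁿ_B = 𝔸ⁿ_k ×_k Spec B`. -/
def timesBase {k : Type*} [CommRing k] (m : ℕ) {n : ℕ} (L' : Set (RelAffineSpace k n)) :
    Set (RelAffineSpace (BaseRing k m) n) :=
  coordProj k m n ⁻¹' L'

/-- The closed subset of `𝔸ⁿ_S` cut out by the linear equations `A x = c`. -/
def linearLocus {S : Type*} [CommRing S] {r n : ℕ} (A : Matrix (Fin r) (Fin n) S)
    (c : Fin r → S) : Set (RelAffineSpace S n) :=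
  PrimeSpectrum.zeroLocus (Set.range fun i : Fin r =>
    (∑ j, MvPolynomial.C (A i j) * MvPolynomial.X j) - MvPolynomial.C (c i))

/-- The rows of `A` are part of a basis of `Sⁿ`, that is, `A` can be completed to an
invertible matrix. If `S` is a field, this says that the rows are linearly independent. -/
def RowsExtendToBasis {S : Type*} [CommRing S] {r n : ℕ} (A : Matrix (Fin r) (Fin n) S) : Prop :=
  ∃ M : Matrix (Fin n) (Fin n) S, IsUnit M.det ∧ ∃ f : Fin r ↪ Fin n, ∀ i j, M (f i) j = A i j

/-- `L` is an affine subspace of `𝔸ⁿ_S` of relative dimension `e` over `S`: after an invertible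
linear change of coordinates of `𝔸ⁿ_S`, it is given by prescribing the values, in `S`, of `n - e`
of the coordinates. -/
def IsAffineSubspace {S : Type*} [CommRing S] {n : ℕ} (L : Set (RelAffineSpace S n))
    (e : ℕ) : Prop :=
  ∃ r : ℕ, e + r = n ∧ ∃ (A : Matrix (Fin r) (Fin n) S) (c : Fin r → S),
    RowsExtendToBasis A ∧ L = linearLocus A c

/-- The fibre of `Z` over the point `p` along `π`, with the subspace topology of `𝔸ⁿ_B`
(this is the topological space of the scheme-theoretic fibre). -/
def fibreOver {k : Type*} [CommRing k] {m n : ℕ} (Z : Set (RelAffineSpace (BaseRing k m) n))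
    (p : PrimeSpectrum (BaseRing k m)) : Set (RelAffineSpace (BaseRing k m) n) :=
  Z ∩ baseProj k m n ⁻¹' {p}

/-- The closure in `Spec B` of the projection of `Z`. -/
def projClosure {k : Type*} [CommRing k] {m n : ℕ}
    (Z : Set (RelAffineSpace (BaseRing k m) n)) : Set (PrimeSpectrum (BaseRing k m)) :=
  closure (baseProj k m n '' Z)

/-- The fibres of `Z` along `π` are generically `d`-dimensional: for all points `p` of some dense
relatively open subset of the projection closure of `Z`, the fibre over `p` has Krull
dimension `d` (in particular it is nonempty). -/
def GenericFibreDim {k : Type*} [CommRing k] {m n : ℕ}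
    (Z : Set (RelAffineSpace (BaseRing k m) n)) (d : ℕ) : Prop :=
  ∃ U : Set (PrimeSpectrum (BaseRing k m)), IsOpen U ∧
    projClosure Z ⊆ closure (U ∩ projClosure Z) ∧
    ∀ p ∈ U ∩ projClosure Z, topologicalKrullDim (fibreOver Z p) = d

/-!
Let `I` be the vanishing ideal of `Γ`, `A = B[x] / I` and `D = B / (I ∩ B)`, a domain containing
`k`, and let `e` be the transcendence degree of `A` over `D`.

*Generic Noether normalization.* For `e` linear forms `y_i = ∑ M_ij x_j` with a generic coefficient
matrix `M` over `k`, the ring `A` becomes integral over `D[y_1, …, y_e]` after inverting a nonzero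
element of `D` (`exists_generic_noether_normalization`). The reason is that `e + 1` linear forms
with indeterminate coefficients satisfy an algebraic relation `g` over the polynomial ring in those
coefficients (`exists_generic_relation`). Replacing the forms by `w = ∑ u_j x_j` and `y_i + a_i w`
turns `g` into a polynomial equation for `w` over `D[y]`, whose leading coefficient is the value at
`(1, a)` of the top homogeneous part of `g`; this is a nonzero polynomial in `u`, `M` and `a`
(`exists_leadingCoeff_isIntegral`). Counting transcendence degrees, the `y_i` are then algebraically
independent.

*Fibres.* Let `p` be a prime of `B` containing `I ∩ B`, but not the inverted element. The fibre over
`p` of the section by `y_i = c_i`, `i ≤ d'`, is the spectrum of an integral extension of the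
polynomial ring over `κ(p)` in the remaining `e - d'` forms: the extension is integral by
construction, and injective because the extension `D[y] ⊆ A` satisfies lying over at primes not
containing the inverted element. So the fibre has dimension `e - d'` for every choice of `c`
(`ringKrullDim_fiber_eq`). For `d' = 0` and `p = I ∩ B` this gives `e = d`, and for general `d'` it
shows that the section has fibres of dimension `d - d'` over a neighbourhood of the generic point of
the projection closure of `Γ`; in particular, the section meets the fibre over that point.

A nonvanishing locus over the domain `k` need not contain a matrix whose rows extend to a basis.
This is arranged by replacing a polynomial `q(M)` by `q(g M)`, where `g` is the leading square block
of a matrix `M₀` with `q(M₀) ≠ 0` and `det g ≠ 0`. The new polynomial is nonzero at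
`g⁻¹ M₀ = (1 | X)`, with `X` over the fraction field of `k`, so it is also nonzero at some `(1 | X)`
with `X` over `k`.
-/

/-! ### Dimension of the fibre rings -/

section

open Function
open scoped TensorProduct

theorem ringKrullDim_eq_of_isIntegral_of_injective {R S : Type*} [CommRing R] [CommRing S]
    [Algebra R S] [Algebra.IsIntegral R S] (hinj : Injective (algebraMap R S)) :
    ringKrullDim S = ringKrullDim R := by
  apply le_antisymm
  · refine Order.krullDim_le_of_strictMono (PrimeSpectrum.comap (algebraMap R S)) fun P Q h ↦ ?_
    exact Ideal.IsIntegral.comap_lt_comap (I := P.asIdeal) (J := Q.asIdeal) h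
  · refine iSup_le fun l ↦ ?_
    obtain ⟨P, -, hP, hPl⟩ := Ideal.exists_ideal_over_prime_of_isIntegral
      (RelSeries.head l).asIdeal (⊥ : Ideal S)
      (by rw [← RingHom.ker_eq_comap_bot, (RingHom.injective_iff_ker_eq_bot _).mp hinj]
          exact bot_le)
    have : P.LiesOver (RelSeries.head l).asIdeal := ⟨hPl.symm⟩
    obtain ⟨L, hL, -, -⟩ := Ideal.exists_ltSeries_of_hasGoingUp l P
    rw [← hL]
    exact le_iSup (fun s : LTSeries (PrimeSpectrum S) ↦ ((s.length : ℕ∞) : WithBot ℕ∞)) L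

/-- If the multiples `f • x j` of generators of `A` are integral over `E`, then `A` is integral over
`E` up to powers of `f`. -/
theorem exists_pow_smul_isIntegral {D A : Type*} [CommRing D] [CommRing A] [Algebra D A]
    (E : Subalgebra D A) {ι : Type*} (x : ι → A) (hx : Algebra.adjoin D (Set.range x) = ⊤) (f : D)
    (hf : ∀ j, IsIntegral E (f • x j)) (a : A) : ∃ N : ℕ, IsIntegral E (f ^ N • a) := by
  have key : ∀ (r : D) (a : A), IsIntegral E a → IsIntegral E (r • a) := fun r a h ↦ by
    have := (isIntegral_algebraMap (R := E) (A := A) (x := algebraMap D E r)).mul h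
    rwa [← IsScalarTower.algebraMap_apply, ← Algebra.smul_def] at this
  have ha : a ∈ Algebra.adjoin D (Set.range x) := hx ▸ Algebra.mem_top
  induction ha using Algebra.adjoin_induction with
  | mem a ha => obtain ⟨j, rfl⟩ := ha; exact ⟨1, by simpa using hf j⟩
  | algebraMap r =>
    refine ⟨0, ?_⟩
    rw [pow_zero, one_smul, IsScalarTower.algebraMap_apply D E A]
    exact isIntegral_algebraMap
  | add a b _ _ h1 h2 =>
    obtain ⟨N, hN⟩ := h1
    obtain ⟨M, hM⟩ := h2
    refine ⟨M + N, ?_⟩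
    rw [smul_add]
    refine .add ?_ ?_
    · rw [pow_add, mul_smul]; exact key _ _ hN
    · rw [add_comm M, pow_add, mul_smul]; exact key _ _ hM
  | mul a b _ _ h1 h2 =>
    obtain ⟨N, hN⟩ := h1
    obtain ⟨M, hM⟩ := h2
    refine ⟨N + M, ?_⟩
    rw [pow_add, ← smul_mul_smul_comm]
    exact hN.mul hM

/-- Lying over for an extension that becomes integral after inverting an element `f` of the base:
the primes of the base not containing `f` are in the image of the spectrum. -/
theorem exists_prime_comap_eq_of_pow_smul_isIntegral {E A : Type*} [CommRing E] [CommRing A]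
    [Algebra E A] (hinj : Injective (algebraMap E A)) (f : E)
    (h : ∀ a : A, ∃ N : ℕ, IsIntegral E (f ^ N • a)) (q : Ideal E) [q.IsPrime] (hfq : f ∉ q) :
    ∃ Q : Ideal A, Q.IsPrime ∧ Q.comap (algebraMap E A) = q := by
  rw [← Ideal.comap_map_eq_self_iff_of_isPrime]
  refine le_antisymm (fun z hz ↦ ?_) Ideal.le_comap_map
  have hinj' : Injective (algebraMap E (integralClosure E A)) := fun a b hab ↦
    hinj congr(($hab : A))
  have hq : (q.map (algebraMap E (integralClosure E A))).comap (algebraMap E _) = q := by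
    rw [Ideal.comap_map_eq_self_iff_of_isPrime]
    obtain ⟨Q, -, hQ⟩ := Ideal.exists_ideal_over_prime_of_isIntegral q
      (⊥ : Ideal (integralClosure E A))
      (by rw [← RingHom.ker_eq_comap_bot, (RingHom.injective_iff_ker_eq_bot _).mp hinj']
          exact bot_le)
    exact ⟨Q, hQ⟩
  -- up to powers of `f`, the extension of `q` to `A` comes from its extension to the integral
  -- closure of `E`, where lying over holds
  have key : ∀ a ∈ q.map (algebraMap E A), ∃ N : ℕ,
      ∃ b ∈ q.map (algebraMap E (integralClosure E A)), (b : A) = f ^ N • a := by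
    intro a ha
    induction ha using Submodule.span_induction with
    | mem a ha =>
      obtain ⟨e, he, rfl⟩ := ha
      exact ⟨0, algebraMap E _ e, Ideal.mem_map_of_mem _ he, by simp⟩
    | zero => exact ⟨0, 0, zero_mem _, by simp⟩
    | add a b _ _ h1 h2 =>
      obtain ⟨N, a', ha', hN⟩ := h1
      obtain ⟨M, b', hb', hM⟩ := h2
      refine ⟨N + M, f ^ M • a' + f ^ N • b',
        add_mem (Submodule.smul_of_tower_mem _ _ ha') (Submodule.smul_of_tower_mem _ _ hb'), ?_⟩
      push_cast
      rw [hN, hM, smul_add, smul_smul, smul_smul, pow_add, mul_comm (f ^ M)]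
    | smul r a _ h1 =>
      obtain ⟨N, a', ha', hN⟩ := h1
      obtain ⟨M, hM⟩ := h r
      refine ⟨M + N, (⟨_, hM⟩ : integralClosure E A) * a', Ideal.mul_mem_left _ _ ha', ?_⟩
      push_cast
      rw [hN, smul_mul_smul_comm, pow_add, smul_eq_mul]
  obtain ⟨N, b, hb, hN⟩ := key _ (Ideal.mem_comap.mp hz)
  have : f ^ N * z ∈ q := by
    rw [← hq, Ideal.mem_comap]
    convert hb
    apply Subtype.ext
    rw [hN, Algebra.smul_def, ← map_mul]
    rfl
  exact (Ideal.IsPrime.mem_or_mem ‹_› this).resolve_left fun h ↦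
    hfq (Ideal.IsPrime.mem_of_pow_mem ‹_› _ h)

/-- Let `y` be a family of algebraically independent elements over which `A` is integral up to
inverting `f`. If `f` is nonzero in `κ(p)`, then the fibre at `p` of the section of `A` by equations
`y i = c i`, `i ∈ ρ`, has dimension the number of remaining members of `y`, since it is an integral
extension of the polynomial ring over `κ(p)` in these. -/
theorem ringKrullDim_fiber_eq {B D A : Type*} [CommRing B] [CommRing D] [CommRing A] [Algebra B D]
    [Algebra B A] [Algebra D A] [IsScalarTower B D A] (hBD : Surjective (algebraMap B D))
    {ρ ς : Type*} [Finite ς] (y : ρ ⊕ ς → A) (hy : AlgebraicIndependent D y)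
    {ι : Type*} (x : ι → A) (hx : Algebra.adjoin D (Set.range x) = ⊤) (f : B)
    (hf : ∀ j, IsIntegral (Algebra.adjoin D (Set.range y)) (f • x j)) (c : ρ → D)
    (p : Ideal B) [p.IsPrime] (hp : RingHom.ker (algebraMap B D) ≤ p) (hfp : f ∉ p) :
    ringKrullDim (p.Fiber (A ⧸ Ideal.span (Set.range fun i ↦
      y (Sum.inl i) - algebraMap D A (c i)))) = Nat.card ς := by
  set J := Ideal.span (Set.range fun i ↦ y (Sum.inl i) - algebraMap D A (c i)) with hJ
  obtain ⟨θ₀, hθ₀⟩ : ∃ θ₀ : D →+* p.ResidueField,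
      ∀ b, θ₀ (algebraMap B D b) = algebraMap B _ b := by
    have hle : RingHom.ker (algebraMap B D) ≤ RingHom.ker (algebraMap B p.ResidueField) :=
      fun b hb ↦ by
        rw [RingHom.mem_ker, Ideal.algebraMap_residueField_eq_zero]
        exact hp hb
    exact ⟨RingHom.liftOfSurjective (algebraMap B D) hBD ⟨algebraMap B _, hle⟩,
      RingHom.liftOfRightInverse_comp_apply _ _ _ _⟩
  have hθ₀0 : ∀ b, θ₀ (algebraMap B D b) = 0 ↔ b ∈ p := fun b ↦ by
    rw [hθ₀, Ideal.algebraMap_residueField_eq_zero]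
  let E := Algebra.adjoin D (Set.range y)
  -- `θ` is the reduction `D[y] → κ(p)[Z_j, j ∈ ς]` that substitutes `c i` for `y i`, `i ∈ ρ`
  let θ' : MvPolynomial (ρ ⊕ ς) D →+* MvPolynomial ς p.ResidueField :=
    MvPolynomial.eval₂Hom (MvPolynomial.C.comp θ₀)
      (Sum.elim (fun i ↦ MvPolynomial.C (θ₀ (c i))) MvPolynomial.X)
  let θ : E →+* MvPolynomial ς p.ResidueField := θ'.comp hy.aevalEquiv.symm.toRingEquiv.toRingHom
  have hθ : ∀ h, θ (hy.aevalEquiv h) = θ' h := fun h ↦ by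
    change θ' (hy.aevalEquiv.symm (hy.aevalEquiv h)) = θ' h
    rw [AlgEquiv.symm_apply_apply]
  have hθalg : ∀ d, θ (algebraMap D E d) = MvPolynomial.C (θ₀ d) := fun d ↦ by
    rw [← hy.aevalEquiv.commutes d, hθ]
    exact MvPolynomial.eval₂_C _ _ _
  let η : MvPolynomial ς p.ResidueField →ₐ[p.ResidueField] p.Fiber (A ⧸ J) :=
    MvPolynomial.aeval fun j ↦ 1 ⊗ₜ Ideal.Quotient.mk J (y (Sum.inr j))
  let φ : A →ₐ[B] p.Fiber (A ⧸ J) :=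
    (Algebra.TensorProduct.includeRight (R := B) (A := p.ResidueField)).comp
      (Ideal.Quotient.mkₐ B J)
  have hcomp : η.toRingHom.comp θ = φ.toRingHom.comp (algebraMap E A) := by
    suffices H : η.toRingHom.comp θ' = φ.toRingHom.comp
        (MvPolynomial.aeval (R := D) y).toRingHom by
      ext e
      obtain ⟨h, rfl⟩ := hy.aevalEquiv.surjective e
      rw [RingHom.comp_apply, hθ]
      exact congr($H h)
    apply MvPolynomial.ringHom_ext
    · intro d
      obtain ⟨b, rfl⟩ := hBD d
      simp only [RingHom.comp_apply, θ', MvPolynomial.coe_eval₂Hom, MvPolynomial.eval₂_C, hθ₀]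
      refine (η.commutes _).trans ?_
      change _ = φ (MvPolynomial.aeval y (MvPolynomial.C (algebraMap B D b)))
      rw [MvPolynomial.aeval_C, ← IsScalarTower.algebraMap_apply,
        ← IsScalarTower.algebraMap_apply B D A, φ.commutes]
    · intro i
      simp only [RingHom.comp_apply, θ', MvPolynomial.coe_eval₂Hom, MvPolynomial.eval₂_X]
      change _ = φ (MvPolynomial.aeval y (MvPolynomial.X i))
      rw [MvPolynomial.aeval_X]
      cases i with
      | inr j => exact MvPolynomial.aeval_X _ _
      | inl i =>
        obtain ⟨b, hb⟩ := hBD (c i)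
        have h1 : Ideal.Quotient.mk J (y (Sum.inl i)) = Ideal.Quotient.mk J (algebraMap B A b) := by
          rw [Ideal.Quotient.eq, IsScalarTower.algebraMap_apply B D A, hb]
          exact Ideal.subset_span ⟨i, rfl⟩
        have h2 : φ (y (Sum.inl i)) = φ (algebraMap B A b) := by
          change 1 ⊗ₜ Ideal.Quotient.mk J _ = 1 ⊗ₜ Ideal.Quotient.mk J _
          rw [h1]
        rw [h2, φ.commutes, Sum.elim_inl, ← hb, hθ₀]
        refine (η.commutes _).trans ?_
        rw [← IsScalarTower.algebraMap_apply]
  have hEA : Injective (algebraMap E A) := Subtype.val_injective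
  have hfx : ∀ j, IsIntegral E (algebraMap B D f • x j) := fun j ↦ by
    rw [algebraMap_smul]; exact hf j
  -- the fibre ring is integral over the polynomial ring
  let _ := η.toRingHom.toAlgebra
  have hstep : ∀ a : A, IsIntegral (MvPolynomial ς p.ResidueField) (φ a) := by
    intro a
    obtain ⟨N, hN⟩ := exists_pow_smul_isIntegral E x hx (algebraMap B D f) hfx a
    have h1 := hN.map_of_comp_eq θ φ.toRingHom hcomp
    have h2 : φ.toRingHom ((algebraMap B D f) ^ N • a) = algebraMap B _ f ^ N * φ a := by
      change φ _ = _
      rw [Algebra.smul_def, ← map_pow, ← IsScalarTower.algebraMap_apply, map_mul, φ.commutes,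
        map_pow]
    rw [h2] at h1
    have h3 := (isIntegral_algebraMap (R := MvPolynomial ς p.ResidueField)
      (A := p.Fiber (A ⧸ J)) (x := MvPolynomial.C ((algebraMap B p.ResidueField f)⁻¹ ^ N))).mul h1
    have h4 : algebraMap (MvPolynomial ς p.ResidueField) (p.Fiber (A ⧸ J))
        (MvPolynomial.C ((algebraMap B p.ResidueField f)⁻¹ ^ N)) =
        algebraMap p.ResidueField _ ((algebraMap B p.ResidueField f)⁻¹ ^ N) := η.commutes _
    have h5 : algebraMap B p.ResidueField f ≠ 0 := by
      rwa [Ne, Ideal.algebraMap_residueField_eq_zero]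
    rw [h4, IsScalarTower.algebraMap_apply B p.ResidueField (p.Fiber (A ⧸ J)), ← mul_assoc,
      ← map_pow, ← map_mul, ← mul_pow, inv_mul_cancel₀ h5, one_pow, map_one, one_mul] at h3
    exact h3
  have hint : Algebra.IsIntegral (MvPolynomial ς p.ResidueField) (p.Fiber (A ⧸ J)) := by
    refine ⟨fun z ↦ ?_⟩
    induction z using TensorProduct.induction_on with
    | zero => exact isIntegral_zero
    | add a b ha hb => exact ha.add hb
    | tmul r s =>
      obtain ⟨a, rfl⟩ := Ideal.Quotient.mk_surjective s
      have h1 := (isIntegral_algebraMap (R := MvPolynomial ς p.ResidueField)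
        (A := p.Fiber (A ⧸ J)) (x := MvPolynomial.C r)).mul (hstep a)
      have h4 : algebraMap (MvPolynomial ς p.ResidueField) (p.Fiber (A ⧸ J))
        (MvPolynomial.C r) = algebraMap p.ResidueField _ r := η.commutes _
      have h5 : (r ⊗ₜ Ideal.Quotient.mk J a : p.Fiber (A ⧸ J)) = algebraMap _ _ r * φ a := by
        change _ = (r ⊗ₜ 1) * (1 ⊗ₜ Ideal.Quotient.mk J a)
        rw [Algebra.TensorProduct.tmul_mul_tmul, mul_one, one_mul]
      rw [h5, ← h4]
      exact h1
  -- Injectivity: lying over gives a prime `Q` of `A` that contracts to `ker θ` in `D[y]`. It is a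
  -- point of the fibre, and the images of the `y j`, `j ∈ ς`, in its residue field are
  -- algebraically independent over `κ(p)`.
  have hinj : Injective η := by
    have hprime : (RingHom.ker θ).IsPrime := RingHom.ker_isPrime θ
    obtain ⟨Q, hQ, hQθ⟩ := exists_prime_comap_eq_of_pow_smul_isIntegral hEA
      (algebraMap D E (algebraMap B D f)) (fun a ↦ by
        obtain ⟨N, hN⟩ := exists_pow_smul_isIntegral E x hx (algebraMap B D f) hfx a
        refine ⟨N, ?_⟩
        rwa [← map_pow, algebraMap_smul]) (RingHom.ker θ) (by
          rw [RingHom.mem_ker, hθalg, map_eq_zero_iff _ (MvPolynomial.C_injective _ _), hθ₀0]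
          exact hfp)
    have hmem : ∀ h, MvPolynomial.aeval y h ∈ Q ↔ θ' h = 0 := fun h ↦ by
      rw [← hθ, ← RingHom.mem_ker, ← hQθ, Ideal.mem_comap, hy.algebraMap_aevalEquiv]
    have hQp : p = Q.comap (algebraMap B A) := by
      ext b
      rw [Ideal.mem_comap, IsScalarTower.algebraMap_apply B D A, ← MvPolynomial.aeval_C y, hmem]
      simp only [θ', MvPolynomial.coe_eval₂Hom, MvPolynomial.eval₂_C, RingHom.comp_apply]
      rw [map_eq_zero_iff _ (MvPolynomial.C_injective _ _), hθ₀0]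
    have hJQ : J ≤ Q := by
      rw [hJ, Ideal.span_le]
      rintro _ ⟨i, rfl⟩
      have := hmem (MvPolynomial.X (Sum.inl i) - MvPolynomial.C (c i))
      simpa [θ'] using this
    let κ : p.ResidueField →ₐ[B] Q.ResidueField :=
      Ideal.ResidueField.mapₐ p Q (Algebra.ofId B A) hQp
    let σ : A ⧸ J →ₐ[B] Q.ResidueField :=
      Ideal.Quotient.liftₐ J (IsScalarTower.toAlgHom B A Q.ResidueField) fun a ha ↦ by
        exact Ideal.algebraMap_residueField_eq_zero.mpr (hJQ ha)
    let ψ : p.Fiber (A ⧸ J) →ₐ[B] Q.ResidueField :=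
      Algebra.TensorProduct.lift κ σ fun _ _ ↦ Commute.all _ _
    let z : ς → Q.ResidueField := fun j ↦ algebraMap A _ (y (Sum.inr j))
    let _ : Algebra p.ResidueField Q.ResidueField := κ.toRingHom.toAlgebra
    let _ : Algebra (B ⧸ p) Q.ResidueField :=
      (κ.toRingHom.comp (algebraMap (B ⧸ p) p.ResidueField)).toAlgebra
    have : IsScalarTower (B ⧸ p) p.ResidueField Q.ResidueField := .of_algebraMap_eq' rfl
    have hBpQ : ∀ b, algebraMap (B ⧸ p) Q.ResidueField (Ideal.Quotient.mk p b) =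
        algebraMap B _ b := fun b ↦ κ.commutes b
    let up : MvPolynomial ς B →+* MvPolynomial (ρ ⊕ ς) D :=
      (MvPolynomial.rename Sum.inr).toRingHom.comp (MvPolynomial.map (algebraMap B D))
    have e1 : (MvPolynomial.aeval (R := B ⧸ p) z).toRingHom.comp
        (MvPolynomial.map (Ideal.Quotient.mk p)) =
        (algebraMap A Q.ResidueField).comp ((MvPolynomial.aeval y).toRingHom.comp up) := by
      apply MvPolynomial.ringHom_ext
      · intro b
        simp [up, hBpQ, ← IsScalarTower.algebraMap_apply]
      · intro j
        simp [up, z]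
    have e2 : θ'.comp up = (MvPolynomial.map (algebraMap (B ⧸ p) p.ResidueField)).comp
        (MvPolynomial.map (Ideal.Quotient.mk p)) := by
      apply MvPolynomial.ringHom_ext
      · intro b
        simp [up, θ', hθ₀]
      · intro j
        simp [up, θ']
    have hz : AlgebraicIndependent (B ⧸ p) z := by
      rw [algebraicIndependent_iff]
      intro h hh
      obtain ⟨h, rfl⟩ := MvPolynomial.map_surjective _ Ideal.Quotient.mk_surjective h
      have h1 : algebraMap A Q.ResidueField (MvPolynomial.aeval y (up h)) = 0 :=
        congr($e1 h).symm.trans hh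
      rw [Ideal.algebraMap_residueField_eq_zero, hmem] at h1
      exact MvPolynomial.map_injective _ (IsFractionRing.injective (B ⧸ p) p.ResidueField)
        (congr($e2 h).symm.trans (h1.trans (map_zero _).symm))
    have hz' : AlgebraicIndependent p.ResidueField z := hz.extendScalars _
    have e3 : ψ.toRingHom.comp η.toRingHom =
        (MvPolynomial.aeval (R := p.ResidueField) z).toRingHom := by
      apply MvPolynomial.ringHom_ext
      · intro r
        simp [η, ψ]
        rfl
      · intro j
        simp [η, ψ, σ, z]
        rfl
    have h3 : Injective (ψ.toRingHom.comp η.toRingHom) := by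
      rw [e3]
      exact hz'
    exact Injective.of_comp h3
  rw [ringKrullDim_eq_of_isIntegral_of_injective hinj,
    MvPolynomial.ringKrullDim_of_isNoetherianRing, ringKrullDim_eq_zero_of_field, zero_add]

end

/-! ### Fibres as topological spaces -/

section

/-- The fibre over `p` of the closed subset of `𝔸ⁿ_B` given by a surjection of `B`-algebras
`B[x] → S` has the dimension of the fibre ring of `S` at `p`, as it is homeomorphic to the spectrum
of that ring. -/
theorem topologicalKrullDim_fibreOver {k : Type*} [CommRing k] {m n : ℕ}
    {S : Type*} [CommRing S] [Algebra (BaseRing k m) S]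
    (g : TotalRing k m n →ₐ[BaseRing k m] S) (hg : Function.Surjective g)
    (Z : Set (RelAffineSpace (BaseRing k m) n))
    (hZ : Z = PrimeSpectrum.zeroLocus (RingHom.ker g))
    (p : PrimeSpectrum (BaseRing k m)) :
    topologicalKrullDim (fibreOver Z p) = ringKrullDim (p.asIdeal.Fiber S) := by
  rw [← PrimeSpectrum.topologicalKrullDim_eq_ringKrullDim,
    ← IsHomeomorph.topologicalKrullDim_eq _
      (PrimeSpectrum.preimageHomeomorphFiber (BaseRing k m) S p).isHomeomorph]
  have hemb : Topology.IsEmbedding (PrimeSpectrum.comap g.toRingHom) :=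
    (PrimeSpectrum.isClosedEmbedding_comap_of_surjective _ g.toRingHom hg).isEmbedding
  have hrange : Set.range (PrimeSpectrum.comap g.toRingHom) = Z := by
    rw [hZ]; exact range_comap_of_surjective _ g.toRingHom hg
  have hpre : PrimeSpectrum.comap (algebraMap (BaseRing k m) S) ⁻¹' {p} =
      PrimeSpectrum.comap g.toRingHom ⁻¹' (baseProj k m n ⁻¹' {p}) := by
    rw [← Set.preimage_comp]
    congr 1
    ext P b
    simp [baseProj]
  have hfib : fibreOver Z p = PrimeSpectrum.comap g.toRingHom ''
      (PrimeSpectrum.comap (algebraMap (BaseRing k m) S) ⁻¹' {p}) := by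
    rw [hpre, Set.image_preimage_eq_range_inter, hrange, fibreOver]
  rw [hfib]
  exact (IsHomeomorph.topologicalKrullDim_eq _ (hemb.homeomorphImage _).isHomeomorph).symm

end

/-! ### Generic algebraic relations and nonvanishing of polynomials -/

section

open Function

/-- More than `trdeg D A` elements of `A[σ]` are algebraically dependent over `D[σ]`: together with
the variables, they would otherwise be algebraically independent over `D`, in a ring of
transcendence degree `trdeg D A + #σ`. -/
theorem exists_generic_relation {D A : Type*} [CommRing D] [IsDomain D] [CommRing A] [IsDomain A]
    [Algebra D A] [FaithfulSMul D A] {e : ℕ} (he : Algebra.trdeg D A = e)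
    {σ τ : Type*} [Finite σ] [Finite τ] (hτ : e < Nat.card τ) (Y : τ → MvPolynomial σ A) :
    ∃ g : MvPolynomial τ (MvPolynomial σ D), g ≠ 0 ∧
      MvPolynomial.eval₂ (MvPolynomial.map (algebraMap D A)) Y g = 0 := by
  let _ : Algebra (MvPolynomial σ D) (MvPolynomial σ A) := MvPolynomial.algebraMvPolynomial
  by_contra! hcon
  have hY : AlgebraicIndependent (MvPolynomial σ D) Y := by
    rw [algebraicIndependent_iff]
    intro g hg
    by_contra hne
    exact hcon g hne hg
  have hX := MvPolynomial.algebraicIndependent_X σ D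
  have h1 := (hX.sumElim_comp hY).lift_cardinalMk_le_trdeg
  have h2 := lift_trdeg_add_eq D A (MvPolynomial σ A)
  cases nonempty_fintype σ
  cases nonempty_fintype τ
  rw [he, MvPolynomial.trdeg_of_isDomain, Cardinal.mk_fintype, Cardinal.lift_natCast,
    Cardinal.lift_natCast, Cardinal.lift_natCast, ← Nat.cast_add, eq_comm,
    Cardinal.lift_eq_nat_iff] at h2
  rw [h2, Cardinal.mk_fintype, Cardinal.lift_natCast, Cardinal.lift_natCast, Nat.cast_le,
    Fintype.card_sum] at h1
  rw [Nat.card_eq_fintype_card] at hτ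
  omega

namespace MvPolynomial

theorem homogeneousComponent_totalDegree_ne_zero {τ R : Type*} [CommRing R] {g : MvPolynomial τ R}
    (hg : g ≠ 0) : homogeneousComponent g.totalDegree g ≠ 0 := by
  obtain ⟨d, hd, hd'⟩ := Finset.exists_mem_eq_sup g.support (support_nonempty.mpr hg)
    (fun s ↦ s.sum fun _ e ↦ e)
  intro h
  have h1 := congr(coeff d $h)
  rw [coeff_homogeneousComponent, if_pos (by rw [totalDegree, hd']; rfl), coeff_zero] at h1
  exact mem_support_iff.mp hd h1

/-- The restriction of a polynomial of degree at most `N` to the line `b + a X` has degree at most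
`N`, and its coefficient in degree `N` is the value at `a` of the homogeneous part of
degree `N`. -/
theorem natDegree_eval₂_line_le_and_coeff {τ R T : Type*} [CommRing R] [CommRing T] (φ : R →+* T)
    (a b : τ → T) (p : MvPolynomial τ R) (N : ℕ) (hN : p.totalDegree ≤ N) :
    (eval₂ (Polynomial.C.comp φ) (fun o ↦ Polynomial.C (b o) + Polynomial.C (a o) * Polynomial.X)
      p).natDegree ≤ N ∧
    (eval₂ (Polynomial.C.comp φ) (fun o ↦ Polynomial.C (b o) + Polynomial.C (a o) * Polynomial.X)
      p).coeff N = eval₂ φ a (homogeneousComponent N p) := by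
  set l : τ → Polynomial T := fun o ↦ Polynomial.C (b o) + Polynomial.C (a o) * Polynomial.X
  have hl : ∀ o, (l o).natDegree ≤ 1 := fun o ↦ by
    simp only [l]; compute_degree
  have hlc : ∀ o, (l o).coeff 1 = a o := fun o ↦ by simp [l, Polynomial.coeff_C]
  have hprod : ∀ d : τ →₀ ℕ, (d.prod fun o e ↦ l o ^ e).natDegree ≤ d.degree ∧
      (d.prod fun o e ↦ l o ^ e).coeff d.degree = d.prod fun o e ↦ a o ^ e := by
    intro d
    induction d using Finsupp.induction with
    | zero => simp
    | single_add o e d ho he ih =>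
      classical
      rw [Finsupp.prod_add_index_of_disjoint, Finsupp.prod_add_index_of_disjoint,
        Finsupp.prod_single_index (by simp), Finsupp.prod_single_index (by simp), map_add,
        Finsupp.degree_single]
      · have h1 : (l o ^ e).natDegree ≤ e :=
          (Polynomial.natDegree_pow_le_of_le e (hl o)).trans (by simp)
        have h2 : (l o ^ e).coeff e = a o ^ e := by
          simpa [hlc] using Polynomial.coeff_pow_of_natDegree_le (m := e) (hl o)
        refine ⟨Polynomial.natDegree_mul_le_of_le h1 ih.1, ?_⟩
        rw [Polynomial.coeff_mul_add_eq_of_natDegree_le h1 ih.1, h2, ih.2]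
      all_goals
        rw [Finset.disjoint_left]
        intro i hi hi'
        exact ho (Finset.mem_singleton.mp (Finsupp.support_single_subset hi) ▸ hi')
  have hterm : ∀ d ∈ p.support,
      (Polynomial.C (φ (coeff d p)) * d.prod fun o e ↦ l o ^ e).natDegree ≤ N := fun d hd ↦
    (Polynomial.natDegree_C_mul_le _ _).trans
      ((hprod d).1.trans ((le_totalDegree hd).trans hN))
  have hsum : eval₂ (Polynomial.C.comp φ) l p =
      ∑ d ∈ p.support, Polynomial.C (φ (coeff d p)) * d.prod fun o e ↦ l o ^ e := rfl
  rw [hsum]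
  refine ⟨Polynomial.natDegree_sum_le_of_forall_le _ _ hterm, ?_⟩
  rw [Polynomial.finsetSum_coeff, homogeneousComponent_apply, eval₂_sum, Finset.sum_filter]
  refine Finset.sum_congr rfl fun d hd ↦ ?_
  rw [Polynomial.coeff_C_mul]
  split_ifs with h
  · rw [eval₂_monomial, ← h, (hprod d).2]
  · have hlt : d.degree < N := lt_of_le_of_ne ((le_totalDegree hd).trans hN) h
    rw [Polynomial.coeff_eq_zero_of_natDegree_lt ((hprod d).1.trans_lt hlt), mul_zero]

/-- A nonzero polynomial over an extension `D` of a domain `k` is nonzero at all points with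
coordinates in `k` outside some proper hypersurface defined over `k`. -/
theorem exists_ne_zero_forall_eval_ne_zero {k D : Type*} [CommRing k] [IsDomain k] [CommRing D]
    [IsDomain D] [Algebra k D] [FaithfulSMul k D] {ν : Type*} (H : MvPolynomial ν D) (hH : H ≠ 0) :
    ∃ H' : MvPolynomial ν k, H' ≠ 0 ∧
      ∀ v : ν → k, eval v H' ≠ 0 → eval (fun i ↦ algebraMap k D (v i)) H ≠ 0 := by
  -- apply to the coefficients of `H` a linear form on the fraction field of `D` over that of `k`,
  -- which does not vanish at one of them, and clear denominators
  let K := FractionRing k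
  let F := FractionRing D
  let _ : Algebra K F := FractionRing.liftAlgebra k F
  obtain ⟨d₀, hd₀⟩ := ne_zero_iff.mp hH
  have hd₀' : algebraMap D F (coeff d₀ H) ≠ 0 := by
    rwa [Ne, FaithfulSMul.algebraMap_eq_zero_iff]
  obtain ⟨l, hl⟩ : ∃ l : Module.Dual K F, l (algebraMap D F (coeff d₀ H)) ≠ 0 := by
    by_contra! h
    exact hd₀' ((Module.forall_dual_apply_eq_zero_iff K _).mp h)
  obtain ⟨b, hb⟩ := IsLocalization.exist_integer_multiples (nonZeroDivisors k) H.support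
    fun d ↦ l (algebraMap D F (coeff d H))
  choose! t ht using hb
  have hb0 : algebraMap k K b ≠ 0 := by
    rw [Ne, FaithfulSMul.algebraMap_eq_zero_iff]
    exact nonZeroDivisors.coe_ne_zero b
  have hd₀s : d₀ ∈ H.support := mem_support_iff.mpr hd₀
  refine ⟨∑ d ∈ H.support, monomial d (t d), fun h ↦ ?_, fun v hv h0 ↦ hv ?_⟩
  · have h1 := congr(coeff d₀ $h)
    classical
    rw [coeff_sum, coeff_zero] at h1
    simp only [coeff_monomial, Finset.sum_ite_eq', hd₀s, if_true] at h1
    have h2 := ht d₀ hd₀s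
    rw [h1, map_zero, Algebra.smul_def] at h2
    exact mul_ne_zero hb0 hl h2.symm
  · apply FaithfulSMul.algebraMap_injective k K
    have h1 : ∀ d ∈ H.support, algebraMap k K (eval v (monomial d (t d))) =
        algebraMap k K b *
          l (algebraMap D F (coeff d H * d.prod fun i e ↦ algebraMap k D (v i) ^ e)) := by
      intro d hd
      rw [eval_monomial, map_mul, ht d hd, Algebra.smul_def, mul_assoc]
      congr 1
      have h2 : algebraMap D F (coeff d H * d.prod fun i e ↦ algebraMap k D (v i) ^ e) =
          algebraMap k K (d.prod fun i e ↦ v i ^ e) • algebraMap D F (coeff d H) := by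
        rw [map_mul, Algebra.smul_def, mul_comm, ← IsScalarTower.algebraMap_apply k K F,
          IsScalarTower.algebraMap_apply k D F]
        simp [Finsupp.prod, map_prod]
      rw [h2, map_smul, smul_eq_mul, mul_comm]
    rw [map_sum, map_sum, Finset.sum_congr rfl h1, ← Finset.mul_sum, ← map_sum, ← map_sum]
    have h3 : ∑ d ∈ H.support, (coeff d H * d.prod fun i e ↦ algebraMap k D (v i) ^ e) =
        eval (fun i ↦ algebraMap k D (v i)) H := rfl
    rw [h3, h0, map_zero, map_zero, mul_zero, map_zero]

end MvPolynomial

end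

/-! ### Integrality over generic linear forms -/

section

open Function MvPolynomial

universe u

theorem MvPolynomial.IsHomogeneous.eval₂_mul_const {τ R T : Type*} [CommRing R] [CommRing T]
    {h : MvPolynomial τ R} {N : ℕ} (hh : h.IsHomogeneous N) (φ : R →+* T) (c : T) (z : τ → T) :
    MvPolynomial.eval₂ φ (fun o ↦ c * z o) h = c ^ N * MvPolynomial.eval₂ φ z h := by
  rw [MvPolynomial.eval₂_eq, MvPolynomial.eval₂_eq, Finset.mul_sum]
  refine Finset.sum_congr rfl fun d hd ↦ ?_
  simp_rw [mul_pow]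
  rw [Finset.prod_mul_distrib, Finset.prod_pow_eq_pow_sum, hh.degree_eq_sum_deg_support hd]
  ring

theorem MvPolynomial.exists_eval_algebraMap_ne_zero {k R ν : Type*} [CommRing k] [Infinite k]
    [CommRing R] [IsDomain R] [Algebra k R] [FaithfulSMul k R] (H : MvPolynomial ν R) (hH : H ≠ 0) :
    ∃ v : ν → k, eval (fun i ↦ algebraMap k R (v i)) H ≠ 0 := by
  by_contra! h
  refine hH (funext_set (fun _ ↦ Set.range (algebraMap k R))
    (fun _ ↦ Set.infinite_range_of_injective (FaithfulSMul.algebraMap_injective k R))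
    fun z hz ↦ ?_)
  choose v hv using fun i ↦ hz i (Set.mem_univ i)
  rw [map_zero, ← h v]
  simp_rw [hv]

/-- For generic `u` and `M`, a nonzero multiple of the linear form `∑ u j * x j` is integral over
the algebra generated by the linear forms `∑ M (i, j) * x j`, as many as the transcendence degree.
The polynomial `H` depends on auxiliary coefficients `a i`. Its value is the leading coefficient of the
relation obtained from a generic one between the form `u` and the forms `M i + a i * u`. -/
theorem exists_leadingCoeff_isIntegral {D : Type u} {A : Type*} [CommRing D] [IsDomain D]
    [Infinite D] [CommRing A] [IsDomain A] [Algebra D A] [FaithfulSMul D A]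
    {ι κ : Type*} [Finite ι] [Fintype κ] (htr : Algebra.trdeg D A = Nat.card ι) (x : κ → A) :
    ∃ H : MvPolynomial (κ ⊕ (ι × κ) ⊕ ι) D, H ≠ 0 ∧ ∀ (u : κ → D) (M : ι × κ → D) (a : ι → D),
      eval (Sum.elim u (Sum.elim M a)) H ≠ 0 →
      IsIntegral (Algebra.adjoin D (Set.range fun i ↦ ∑ j, algebraMap D A (M (i, j)) * x j))
        (eval (Sum.elim u (Sum.elim M a)) H • ∑ j, algebraMap D A (u j) * x j) := by
  cases nonempty_fintype ι
  obtain ⟨g, hg0, hg⟩ := exists_generic_relation (σ := Option ι × κ) (τ := Option ι) htr (by simp)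
    (fun o ↦ ∑ j, X (o, j) * C (x j))
  set N := g.totalDegree
  set h := homogeneousComponent N g with hh
  have hh0 : h ≠ 0 := homogeneousComponent_totalDegree_ne_zero hg0
  have hhN : h.IsHomogeneous N := homogeneousComponent_isHomogeneous N g
  let τ : Option ι × κ → MvPolynomial (κ ⊕ (ι × κ) ⊕ ι) D := fun oj ↦ oj.1.elim (X (Sum.inl oj.2))
    fun i ↦ X (Sum.inr (Sum.inl (i, oj.2))) + X (Sum.inr (Sum.inr i)) * X (Sum.inl oj.2)
  let α : Option ι → MvPolynomial (κ ⊕ (ι × κ) ⊕ ι) D := fun o ↦ o.elim 1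
    fun i ↦ X (Sum.inr (Sum.inr i))
  let H := eval₂ (eval₂Hom C τ) α h
  have hH : ∀ {T : Type u} [CommRing T] [Algebra D T] (v : κ ⊕ (ι × κ) ⊕ ι → T),
      aeval v H = eval₂ (aeval (fun oj ↦ aeval v (τ oj))).toRingHom (fun o ↦ aeval v (α o)) h := by
    intro T _ _ v
    change (aeval v).toRingHom (eval₂ (eval₂Hom C τ) α h) = _
    rw [hom_eval₂]
    congr 1
    apply ringHom_ext
    · intro r; simp
    · intro r; simp
  refine ⟨H, ?_, fun u M a hne ↦ ?_⟩
  -- `H` is nonzero: if `h` does not vanish for the coefficients `t` at a point `b` with nonzero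
  -- coordinate `b none`, rescale `b` to `(1, a)` over the fraction field and solve for `u` and `M`
  · let F := FractionRing D
    have hX : h * X none ≠ 0 := mul_ne_zero hh0 (X_ne_zero _)
    obtain ⟨b, hb⟩ := exists_eval_algebraMap_ne_zero (k := D) _ hX
    obtain ⟨t, ht⟩ := exists_eval_algebraMap_ne_zero (k := D) _ hb
    rw [map_mul, map_mul, eval_X] at ht
    have hb0 : algebraMap D F (b none) ≠ 0 := by
      rw [Ne, FaithfulSMul.algebraMap_eq_zero_iff]
      rintro h0
      simp [h0] at ht
    have ht' := left_ne_zero_of_mul ht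
    let a : ι → F := fun i ↦ algebraMap D F (b (some i)) / algebraMap D F (b none)
    let v : κ ⊕ (ι × κ) ⊕ ι → F := Sum.elim (fun j ↦ algebraMap D F (t (none, j)))
      (Sum.elim (fun ij ↦ algebraMap D F (t (some ij.1, ij.2)) -
        a ij.1 * algebraMap D F (t (none, ij.2))) a)
    have hτ : ∀ oj, aeval v (τ oj) = algebraMap D F (t oj) := by
      rintro ⟨o | i, j⟩
      · simp [τ, v]
      · simp [τ, v]
    have hα : ∀ o, algebraMap D F (b o) = algebraMap D F (b none) * aeval v (α o) := by
      rintro (o | i)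
      · simp [α]
      · simp only [α, v, a, Option.elim_some, aeval_X, Sum.elim_inr]
        exact (mul_div_cancel₀ _ hb0).symm
    intro hH0
    have h1 := hH v
    rw [hH0, map_zero] at h1
    simp_rw [hτ] at h1
    have h2 := hhN.eval₂_mul_const (aeval fun oj ↦ algebraMap D F (t oj)).toRingHom
      (algebraMap D F (b none)) fun o ↦ aeval v (α o)
    rw [← h1, mul_zero] at h2
    simp_rw [← hα] at h2
    apply ht'
    apply FaithfulSMul.algebraMap_injective D F
    rw [map_zero, ← h2]
    change ((algebraMap D F).comp (MvPolynomial.eval t))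
      (MvPolynomial.eval₂ (RingHom.id _) (fun o ↦ C (b o)) h) = _
    rw [hom_eval₂]
    congr 1
    · apply ringHom_ext
      · intro r; simp
      · intro r; simp
    · ext o; simp
  -- the generic relation, specialized at the forms `u` and `M i + a i * u`, is an equation for `w`
  · set w := ∑ j, algebraMap D A (u j) * x j with hw
    set v := Sum.elim u (Sum.elim M a) with hv
    set E := Algebra.adjoin D (Set.range fun i ↦ ∑ j, algebraMap D A (M (i, j)) * x j)
    let t : Option ι × κ → D := fun oj ↦ eval v (τ oj)
    let φ : MvPolynomial (Option ι × κ) D →+* E := (algebraMap D E).comp (eval t)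
    let a' : Option ι → E := fun o ↦ algebraMap D E (eval v (α o))
    let b' : Option ι → E := fun o ↦ o.elim 0 fun i ↦ ⟨_, Algebra.subset_adjoin ⟨i, rfl⟩⟩
    obtain ⟨hdeg, hcoef⟩ := natDegree_eval₂_line_le_and_coeff φ a' b' g N le_rfl
    set G := eval₂ (Polynomial.C.comp φ)
      (fun o ↦ Polynomial.C (b' o) + Polynomial.C (a' o) * Polynomial.X) g
    have hc : G.coeff N = algebraMap D E (eval v H) := by
      rw [hcoef, ← coe_aeval_eq_eval, RingHom.coe_coe, hH, hom_eval₂]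
      congr 1
    have hG : Polynomial.aeval w G = 0 := by
      have h1 := congr(MvPolynomial.eval (fun oj ↦ algebraMap D A (t oj)) $hg)
      rw [map_zero, hom_eval₂] at h1
      refine Eq.trans ?_ h1
      change (Polynomial.aeval w).toRingHom (eval₂ _ _ g) = _
      rw [hom_eval₂]
      congr 1
      · apply ringHom_ext
        · intro r
          simp [φ]
        · intro r
          simp [φ]
      · ext o
        rcases o with _ | i
        · simp [a', b', α, t, τ, v, hw]
        · simp [a', b', α, t, τ, v, hw, add_mul, Finset.sum_add_distrib, Finset.mul_sum, mul_assoc]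
    have hlc : G.leadingCoeff = algebraMap D E (eval v H) := by
      rw [← hc, Polynomial.leadingCoeff, le_antisymm hdeg (Polynomial.le_natDegree_of_ne_zero ?_)]
      rwa [hc, Ne, FaithfulSMul.algebraMap_eq_zero_iff]
    have := isIntegral_leadingCoeff_smul G w hG
    rwa [hlc, algebraMap_smul] at this

/-- A nonvanishing condition with coefficients in `k` under which a multiple of one linear form over
`k` is integral over the algebra generated by others. -/
theorem exists_generic_isIntegral {k A : Type*} {D : Type u} [CommRing k] [IsDomain k] [Infinite k]
    [CommRing D] [IsDomain D] [CommRing A] [IsDomain A] [Algebra k D] [Algebra D A] [Algebra k A]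
    [IsScalarTower k D A] [FaithfulSMul k D] [FaithfulSMul D A] {ι κ : Type*} [Finite ι] [Fintype κ]
    (htr : Algebra.trdeg D A = Nat.card ι) (x : κ → A) :
    ∃ H : MvPolynomial (κ ⊕ (ι × κ) ⊕ ι) k, H ≠ 0 ∧ ∀ (u : κ → k) (M : ι × κ → k) (a : ι → k),
      eval (Sum.elim u (Sum.elim M a)) H ≠ 0 → ∃ f : D, f ≠ 0 ∧
      IsIntegral (Algebra.adjoin D (Set.range fun i ↦ ∑ j, algebraMap k A (M (i, j)) * x j))
        (f • ∑ j, algebraMap k A (u j) * x j) := by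
  have : Infinite D := Infinite.of_injective _ (FaithfulSMul.algebraMap_injective k D)
  obtain ⟨H, hH, hint⟩ := exists_leadingCoeff_isIntegral htr x
  obtain ⟨H', hH', hne⟩ := exists_ne_zero_forall_eval_ne_zero (k := k) H hH
  refine ⟨H', hH', fun u M a h ↦ ?_⟩
  have h1 : (fun i ↦ algebraMap k D (Sum.elim u (Sum.elim M a) i)) =
      Sum.elim (fun j ↦ algebraMap k D (u j)) (Sum.elim (fun ij ↦ algebraMap k D (M ij))
        fun i ↦ algebraMap k D (a i)) := by
    ext (i | i | i) <;> rfl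
  have h2 := hne _ h
  rw [h1] at h2
  have h3 := hint _ _ _ h2
  have h4 : (fun i ↦ ∑ j, algebraMap D A (algebraMap k D (M (i, j))) * x j) =
      fun i ↦ ∑ j, algebraMap k A (M (i, j)) * x j := by
    simp_rw [← IsScalarTower.algebraMap_apply k D A]
  have h5 : ∑ j, algebraMap D A (algebraMap k D (u j)) * x j = ∑ j, algebraMap k A (u j) * x j := by
    simp_rw [← IsScalarTower.algebraMap_apply k D A]
  rw [h4, h5] at h3
  exact ⟨_, h2, h3⟩

/-- If `A` has transcendence degree equal to the size of a family `y`, and becomes integral over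
`D[y]` after inverting a nonzero element of `D`, then `y` is algebraically independent. -/
theorem algebraicIndependent_of_isIntegral {D A : Type*} [CommRing D] [IsDomain D] [CommRing A]
    [IsDomain A] [Algebra D A] [FaithfulSMul D A] {ι κ : Type*} [Finite ι]
    (htr : Algebra.trdeg D A = Nat.card ι) (x : κ → A)
    (hx : Algebra.adjoin D (Set.range x) = ⊤) (y : ι → A) (f : D) (hf0 : f ≠ 0)
    (hf : ∀ j, IsIntegral (Algebra.adjoin D (Set.range y)) (f • x j)) :
    AlgebraicIndependent D y := by
  have : Algebra.IsAlgebraic (Algebra.adjoin D (Set.range y)) A := by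
    refine ⟨fun a ↦ ?_⟩
    obtain ⟨N, hN⟩ := exists_pow_smul_isIntegral _ x hx f hf a
    have h1 := hN.isAlgebraic
    rw [Algebra.smul_def] at h1
    refine IsAlgebraic.of_mul (mem_nonZeroDivisors_of_ne_zero ?_) ?_ h1
    · rw [Ne, FaithfulSMul.algebraMap_eq_zero_iff]
      exact pow_ne_zero N hf0
    · rw [IsScalarTower.algebraMap_apply D (Algebra.adjoin D (Set.range y)) A]
      exact isAlgebraic_algebraMap _
  refine (Algebra.IsAlgebraic.isTranscendenceBasis_of_lift_le_trdeg_of_finite D y ?_).1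
  rw [htr]
  cases nonempty_fintype ι
  simp

theorem trdeg_le_of_adjoin_eq_top {D A : Type*} [CommRing D] [IsDomain D] [CommRing A]
    [IsDomain A] [Algebra D A] {n : ℕ} (x : Fin n → A)
    (hx : Algebra.adjoin D (Set.range x) = ⊤) : Algebra.trdeg D A ≤ n := by
  have : Algebra.IsAlgebraic (Algebra.adjoin D (Set.range x)) A := by
    refine ⟨fun a ↦ ?_⟩
    have ha : a ∈ Algebra.adjoin D (Set.range x) := hx ▸ Algebra.mem_top
    exact isAlgebraic_algebraMap (⟨a, ha⟩ : Algebra.adjoin D (Set.range x))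
  refine (Algebra.IsAlgebraic.trdeg_le_cardinalMk D (Set.range x)).trans ?_
  simpa using Cardinal.mk_range_le_lift (f := x)

end

/-! ### Generic Noether normalization over an infinite domain -/

section

open Function MvPolynomial

universe u w

theorem IsIntegral.of_subalgebra_le {D A : Type*} [CommRing D] [CommRing A] [Algebra D A]
    {E E' : Subalgebra D A} (h : E ≤ E') {a : A} (ha : IsIntegral E a) : IsIntegral E' a :=
  ha.map_of_comp_eq (Subalgebra.inclusion h).toRingHom (RingHom.id A) rfl

/-- A matrix whose leading square block is the identity can be completed to an invertible matrix. -/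
theorem rowsExtendToBasis_of_leading_one {S : Type*} [CommRing S] {r n : ℕ} (hrn : r ≤ n)
    (A : Matrix (Fin r) (Fin n) S)
    (hA : ∀ i (j : Fin n), (j : ℕ) < r → A i j = if (i : ℕ) = j then 1 else 0) :
    RowsExtendToBasis A := by
  refine ⟨Matrix.of fun i j ↦ if h : (i : ℕ) < r then A ⟨i, h⟩ j else if i = j then 1 else 0, ?_,
    ⟨Fin.castLE hrn, Fin.castLE_injective hrn⟩, fun i j ↦ by simp⟩
  rw [Matrix.det_of_isUpperTriangular]
  · rw [Finset.prod_eq_one]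
    · exact isUnit_one
    · intro i _
      rw [Matrix.of_apply]
      by_cases h : (i : ℕ) < r
      · simp [h, hA ⟨i, h⟩ i h]
      · simp [h]
  · intro i j hij
    have hij' : (j : ℕ) < i := hij
    rw [Matrix.of_apply]
    split_ifs with h h2
    · rw [hA _ _ (hij'.trans h), if_neg hij'.ne']
    · omega
    · rfl

theorem exists_ne_zero_eval_line_ne_zero {k ν : Type*} [CommRing k] [IsDomain k] [Infinite k]
    (H : MvPolynomial ν k) (v w : ν → k) (hv : eval v H ≠ 0) :
    ∃ s : k, s ≠ 0 ∧ eval (fun i ↦ v i + s * w i) H ≠ 0 := by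
  let P : Polynomial k := aeval (fun i ↦ Polynomial.C (v i) + Polynomial.X * Polynomial.C (w i)) H
  have hP : ∀ s, P.eval s = eval (fun i ↦ v i + s * w i) H := fun s ↦ by
    change Polynomial.evalRingHom s (aeval _ H) = _
    rw [aeval_def, hom_eval₂, MvPolynomial.eval, coe_eval₂Hom]
    congr 1
    · ext; simp
    · ext i
      simp [mul_comm s (w i)]
  have hP0 : P * Polynomial.X ≠ 0 := by
    refine mul_ne_zero (fun h ↦ hv ?_) Polynomial.X_ne_zero
    simpa [h] using (hP 0).symm
  by_contra! hcon
  refine hP0 (Polynomial.funext fun s ↦ ?_)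
  by_cases hs : s = 0
  · simp [hs]
  · simp [hP, hcon s hs]

/-- Generic Noether normalization: outside a hypersurface over `k`, the linear forms with
coefficients in a matrix `M` over `k` can be completed to `trdeg D A` algebraically independent
elements over which `A` is integral up to inverting a nonzero element of `D`. The hypersurface does
not contain all the matrices whose rows extend to a basis over `k`. -/
theorem exists_generic_noether_normalization {k : Type w} {A : Type*} {D : Type u} [CommRing k]
    [IsDomain k] [Infinite k] [CommRing D] [IsDomain D] [CommRing A] [IsDomain A] [Algebra k D]
    [Algebra D A] [Algebra k A] [IsScalarTower k D A] [FaithfulSMul k D] [FaithfulSMul D A] {n : ℕ}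
    (x : Fin n → A) (hx : Algebra.adjoin D (Set.range x) = ⊤) (r s : ℕ)
    (htr : Algebra.trdeg D A = (r + s : ℕ)) :
    ∃ q : MvPolynomial (Fin r × Fin n) k,
      (∃ M : Matrix (Fin r) (Fin n) k, RowsExtendToBasis M ∧ eval (fun ij ↦ M ij.1 ij.2) q ≠ 0) ∧
      ∀ M : Matrix (Fin r) (Fin n) k, eval (fun ij ↦ M ij.1 ij.2) q ≠ 0 →
        ∃ y : Fin r ⊕ Fin s → A, (∀ i, y (Sum.inl i) = ∑ j, algebraMap k A (M i j) * x j) ∧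
          AlgebraicIndependent D y ∧
          ∃ f : D, f ≠ 0 ∧ ∀ j, IsIntegral (Algebra.adjoin D (Set.range y)) (f • x j) := by
  have hrn : r ≤ n := by
    have := trdeg_le_of_adjoin_eq_top x hx
    rw [htr, Nat.cast_le] at this
    omega
  have htr' : Algebra.trdeg D A = Nat.card (Fin r ⊕ Fin s) := by simpa using htr
  obtain ⟨H, hH, hint⟩ := exists_generic_isIntegral (k := k) htr' x
  -- a point where `H` and the leading minor do not vanish
  let Δ : MvPolynomial (Fin n ⊕ ((Fin r ⊕ Fin s) × Fin n) ⊕ (Fin r ⊕ Fin s)) k :=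
    (Matrix.of fun i l : Fin r ↦ X (Sum.inr (Sum.inl (Sum.inl i, Fin.castLE hrn l)))).det
  have hΔ : ∀ v, eval v Δ =
      (Matrix.of fun i l : Fin r ↦ v (Sum.inr (Sum.inl (Sum.inl i, Fin.castLE hrn l)))).det := by
    intro v
    rw [RingHom.map_det]
    congr 1
    ext i l
    simp
  have hΔ0 : Δ ≠ 0 := by
    intro h
    have h1 := hΔ (Sum.elim 0 (Sum.elim
      (fun ij ↦ ij.1.elim (fun i : Fin r ↦ if (i : ℕ) = ij.2 then 1 else 0) 0) 0))
    rw [h, map_zero] at h1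
    refine one_ne_zero (α := k) (Eq.trans ?_ h1.symm)
    rw [← Matrix.det_one (n := Fin r)]
    congr 1
    ext i l
    simp [Matrix.one_apply, Fin.ext_iff]
  obtain ⟨v, hv⟩ := exists_eval_algebraMap_ne_zero (k := k) _ (mul_ne_zero hH hΔ0)
  simp only [Algebra.algebraMap_self, RingHom.id_apply, map_mul] at hv
  have hvH := left_ne_zero_of_mul hv
  have hvΔ := right_ne_zero_of_mul hv
  rw [hΔ] at hvΔ
  let u₀ : Fin n → k := fun j ↦ v (Sum.inl j)
  let M₀ : (Fin r ⊕ Fin s) × Fin n → k := fun ij ↦ v (Sum.inr (Sum.inl ij))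
  let a₀ : Fin r ⊕ Fin s → k := fun i ↦ v (Sum.inr (Sum.inr i))
  have hv' : v = Sum.elim u₀ (Sum.elim M₀ a₀) := by ext (i | i | i) <;> rfl
  set g : Matrix (Fin r) (Fin r) k :=
    Matrix.of fun i l : Fin r ↦ M₀ (Sum.inl i, Fin.castLE hrn l) with hg
  have hg0 : g.det ≠ 0 := hvΔ
  -- the linear forms `U o` span all of them over the fraction field, and `H` vanishes at none
  choose t ht0 ht using fun j : Fin n ↦
    exists_ne_zero_eval_line_ne_zero H v (Sum.elim (Pi.single j 1) 0) hvH
  let U : Option (Fin n) → Fin n → k := fun o ↦ o.elim u₀ fun j ↦ u₀ + Pi.single j (t j)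
  have hU : ∀ o, eval (Sum.elim (U o) (Sum.elim M₀ a₀)) H ≠ 0 := by
    rintro (_ | j)
    · change eval (Sum.elim u₀ (Sum.elim M₀ a₀)) H ≠ 0
      rwa [← hv']
    · convert ht j using 4 with i
      rcases i with i | i | i
      · simp [U, u₀, Pi.single_apply]
      · simp [M₀]
      · simp [a₀]
  -- The last `s` rows are those of `M₀`, and the first `r` rows are those of `g * M`. The factor
  -- `g` is harmless, as the forms given by `g * M` are combinations of those given by `M`, and makes
  -- the polynomial nonzero at the matrix `g⁻¹ * M₀` over the fraction field, whose leading block is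
  -- the identity.
  let sub : Option (Fin n) → Fin n ⊕ ((Fin r ⊕ Fin s) × Fin n) ⊕ (Fin r ⊕ Fin s) →
      MvPolynomial (Fin r × Fin n) k := fun o ↦ Sum.elim (fun j ↦ C (U o j)) (Sum.elim
        (fun ij ↦ ij.1.elim (fun i ↦ ∑ l, C (g i l) * X (l, ij.2)) fun i ↦ C (M₀ (Sum.inr i, ij.2)))
        fun i ↦ C (a₀ i))
  let q : MvPolynomial (Fin r × Fin n) k := ∏ o, aeval (sub o) H
  let N : ∀ {T : Type w} [CommRing T] [Algebra k T], (Fin r × Fin n → T) →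
    (Fin r ⊕ Fin s) × Fin n → T := fun M ij ↦
      ij.1.elim (fun i ↦ ∑ l, algebraMap k _ (g i l) * M (l, ij.2))
        fun i ↦ algebraMap k _ (M₀ (Sum.inr i, ij.2))
  have hq : ∀ {T : Type w} [CommRing T] [Algebra k T] (M : Fin r × Fin n → T),
      aeval M q = ∏ o, aeval (Sum.elim (fun j ↦ algebraMap k T (U o j)) (Sum.elim (N M)
        fun i ↦ algebraMap k T (a₀ i))) H := by
    intro T _ _ M
    rw [map_prod]
    refine Finset.prod_congr rfl fun o _ ↦ ?_
    rw [← AlgHom.comp_apply, comp_aeval]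
    congr 2
    ext (j | ⟨i | i, j⟩ | i) <;> simp [sub, N]
  refine ⟨q, ?_, fun M hM ↦ ?_⟩
  · let δ : Fin r × Fin n → k := fun ij ↦ if (ij.1 : ℕ) = ij.2 then 1 else 0
    let p : MvPolynomial (Fin r × Fin n) k :=
      aeval (fun ij ↦ if (ij.2 : ℕ) < r then C (δ ij) else X ij) q
    have hp : ∀ {T : Type w} [CommRing T] [Algebra k T] (Y : Fin r × Fin n → T),
        aeval Y p = aeval (fun ij ↦ if (ij.2 : ℕ) < r then algebraMap k T (δ ij) else Y ij) q := by
      intro T _ _ Y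
      rw [← AlgHom.comp_apply, comp_aeval]
      congr 2
      ext ij
      split_ifs <;> simp
    -- `p` is the restriction of `q` to the matrices whose leading block is the identity
    have hp0 : p ≠ 0 := by
      let K := FractionRing k
      let gK : Matrix (Fin r) (Fin r) K := (algebraMap k K).mapMatrix g
      have hgK : IsUnit gK.det := by
        rw [isUnit_iff_ne_zero, ← RingHom.map_det, Ne, FaithfulSMul.algebraMap_eq_zero_iff]
        exact hg0
      let M₁ : Matrix (Fin r) (Fin n) K := Matrix.of fun i j ↦ algebraMap k K (M₀ (Sum.inl i, j))
      let Y : Matrix (Fin r) (Fin n) K := gK⁻¹ * M₁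
      have hY : gK * Y = M₁ := Matrix.mul_nonsing_inv_cancel_left _ _ hgK
      have hYδ : ∀ i (j : Fin n), (j : ℕ) < r → Y i j = algebraMap k K (δ (i, j)) := by
        intro i j hj
        have h1 : Y.submatrix id (Fin.castLE hrn) = 1 := by
          rw [← Matrix.nonsing_inv_mul gK hgK, Matrix.submatrix_mul _ _ id id _ bijective_id]
          rfl
        have h2 := congr($h1 i ⟨j, hj⟩)
        rw [Matrix.one_apply] at h2
        simp only [Fin.ext_iff] at h2
        refine Eq.trans h2 ?_
        simp only [δ]
        split_ifs <;> simp
      intro h0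
      have h1 := hp (T := K) fun ij ↦ Y ij.1 ij.2
      have h2 : (fun ij : Fin r × Fin n ↦ if (ij.2 : ℕ) < r then algebraMap k K (δ ij)
          else Y ij.1 ij.2) = fun ij ↦ Y ij.1 ij.2 := by
        ext ⟨i, j⟩
        split_ifs with h
        · exact (hYδ i j h).symm
        · rfl
      have h3 : N (T := K) (fun ij ↦ Y ij.1 ij.2) = fun ij ↦ algebraMap k K (M₀ ij) := by
        ext ⟨i | i, j⟩
        · exact congr($hY i j)
        · rfl
      rw [h0, map_zero, h2, hq, h3, eq_comm, Finset.prod_eq_zero_iff] at h1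
      obtain ⟨o, -, ho⟩ := h1
      apply hU o
      apply FaithfulSMul.algebraMap_injective k K
      rw [map_zero, ← ho]
      change algebraMap k K (MvPolynomial.eval₂ (RingHom.id k) _ H) = MvPolynomial.eval₂ _ _ H
      rw [hom_eval₂, RingHom.comp_id]
      congr 1
      ext (j | j | j) <;> rfl
    obtain ⟨Y, hY⟩ := exists_eval_algebraMap_ne_zero (k := k) _ hp0
    refine ⟨fun i j ↦ if (j : ℕ) < r then δ (i, j) else Y (i, j),
      rowsExtendToBasis_of_leading_one hrn _ fun i j hj ↦ by simp [hj, δ], ?_⟩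
    have h1 := hp Y
    rw [aeval_eq_eval, aeval_eq_eval] at h1
    exact fun h ↦ hY (h1.trans h)
  · let y : Fin r ⊕ Fin s → A := Sum.elim (fun i ↦ ∑ j, algebraMap k A (M i j) * x j)
      fun i ↦ ∑ j, algebraMap k A (M₀ (Sum.inr i, j)) * x j
    have hle : Algebra.adjoin D (Set.range fun i ↦
        ∑ j, algebraMap k A (N (fun ij ↦ M ij.1 ij.2) (i, j)) * x j) ≤
        Algebra.adjoin D (Set.range y) := by
      rw [Algebra.adjoin_le_iff]
      rintro _ ⟨i | i, rfl⟩
      · have h1 : ∑ j, algebraMap k A (N (fun ij ↦ M ij.1 ij.2) (Sum.inl i, j)) * x j =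
            ∑ l, algebraMap k D (g i l) • y (Sum.inl l) := by
          simp only [N, y, Sum.elim_inl, Algebra.smul_def, ← IsScalarTower.algebraMap_apply,
            map_sum, Finset.sum_mul, Finset.mul_sum, map_mul, Algebra.algebraMap_self,
            RingHom.id_apply, mul_assoc]
          exact Finset.sum_comm
        simp only [h1]
        exact sum_mem fun l _ ↦ Subalgebra.smul_mem _
          (Algebra.subset_adjoin (Set.mem_range_self (Sum.inl l))) _
      · exact Algebra.subset_adjoin ⟨Sum.inr i, rfl⟩
    have hM' : ∀ o, eval (Sum.elim (U o) (Sum.elim (N fun ij ↦ M ij.1 ij.2) a₀)) H ≠ 0 := by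
      have h1 := hq (T := k) fun ij ↦ M ij.1 ij.2
      simp only [aeval_eq_eval, Algebra.algebraMap_self, RingHom.id_apply] at h1
      intro o ho
      exact hM (h1.trans (Finset.prod_eq_zero (Finset.mem_univ o) ho))
    choose f hf0 hf using fun o ↦ hint _ _ _ (hM' o)
    have hF : ∀ o, IsIntegral (Algebra.adjoin D (Set.range y))
        ((∏ o, f o) • ∑ j, algebraMap k A (U o j) * x j) := by
      intro o
      obtain ⟨c, hc⟩ := Finset.dvd_prod_of_mem f (Finset.mem_univ o)
      rw [hc, mul_comm, mul_smul]
      exact ((hf o).of_subalgebra_le hle).smul c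
    have hne : (∏ o, f o) * ∏ j, algebraMap k D (t j) ≠ 0 := by
      refine mul_ne_zero (Finset.prod_ne_zero_iff.mpr fun o _ ↦ hf0 o)
        (Finset.prod_ne_zero_iff.mpr fun j _ ↦ ?_)
      rw [Ne, FaithfulSMul.algebraMap_eq_zero_iff]
      exact ht0 j
    have hfin : ∀ j, IsIntegral (Algebra.adjoin D (Set.range y))
        (((∏ o, f o) * ∏ j, algebraMap k D (t j)) • x j) := by
      intro j
      obtain ⟨c, hc⟩ := Finset.dvd_prod_of_mem (fun j ↦ algebraMap k D (t j)) (Finset.mem_univ j)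
      have h1 : ∑ i, algebraMap k A (U (some j) i) * x i - ∑ i, algebraMap k A (U none i) * x i =
          algebraMap k D (t j) • x j := by
        rw [← Finset.sum_sub_distrib]
        simp [U, add_mul, Pi.single_apply, apply_ite (algebraMap k A), Algebra.smul_def,
          ← IsScalarTower.algebraMap_apply]
      have h2 := ((hF (some j)).sub (hF none)).smul c
      rw [← smul_sub, h1, smul_smul, smul_smul] at h2
      convert h2 using 2
      rw [hc]
      ring
    exact ⟨y, fun i ↦ rfl, algebraicIndependent_of_isIntegral htr' x hx y _ hne hfin, _, hne, hfin⟩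

end

/-! ### Linear sections and their fibres -/

section

open Function MvPolynomial

theorem RowsExtendToBasis.map {S T : Type*} [CommRing S] [CommRing T] (φ : S →+* T) {r n : ℕ}
    {A : Matrix (Fin r) (Fin n) S} (hA : RowsExtendToBasis A) : RowsExtendToBasis (A.map φ) := by
  obtain ⟨M, hM, f, hf⟩ := hA
  refine ⟨M.map φ, ?_, f, fun i j ↦ by simp [hf]⟩
  have := hM.map φ
  rwa [RingHom.map_det] at this

theorem mem_timesBase_linearLocus {k : Type*} [CommRing k] {m n r : ℕ}
    (A : Matrix (Fin r) (Fin n) k) (c : Fin r → k) (P : RelAffineSpace (BaseRing k m) n) :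
    P ∈ timesBase m (linearLocus A c) ↔
      ∀ i, (∑ j, C (C (A i j)) * X j) - C (C (c i)) ∈ P.asIdeal := by
  rw [timesBase, Set.mem_preimage, linearLocus, PrimeSpectrum.mem_zeroLocus, Set.range_subset_iff]
  refine forall_congr' fun i ↦ ?_
  rw [coordProj, PrimeSpectrum.comap_asIdeal, SetLike.mem_coe, Ideal.mem_comap]
  simp

theorem timesBase_linearLocus {k : Type*} [CommRing k] (m : ℕ) {n r : ℕ}
    (A : Matrix (Fin r) (Fin n) k) (c : Fin r → k) :
    timesBase m (linearLocus A c) =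
      linearLocus (A.map (C : k →+* BaseRing k m)) (fun i ↦ (C (c i) : BaseRing k m)) := by
  ext P
  rw [mem_timesBase_linearLocus, linearLocus, PrimeSpectrum.mem_zeroLocus, Set.range_subset_iff]
  rfl

theorem fibreOver_nonempty_of_dim_eq {k : Type*} [CommRing k] {m n : ℕ}
    {Z : Set (RelAffineSpace (BaseRing k m) n)} {p : PrimeSpectrum (BaseRing k m)} {s : ℕ}
    (h : topologicalKrullDim (fibreOver Z p) = s) : (fibreOver Z p).Nonempty := by
  by_contra hne
  rw [Set.not_nonempty_iff_eq_empty] at hne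
  have : IsEmpty (fibreOver Z p) := by rw [hne]; infer_instance
  have : IsEmpty (TopologicalSpace.IrreducibleCloseds (fibreOver Z p)) :=
    ⟨fun T ↦ IsEmpty.false T.isIrreducible.1.some⟩
  rw [topologicalKrullDim, Order.krullDim_eq_bot] at h
  exact WithBot.bot_ne_coe h

/-- If the fibres of `Z ⊆ Γ` have dimension `s` over a neighbourhood in the projection closure of
`Γ` of its generic point `p₀`, then `Z` has the same projection closure, because its fibre over `p₀`
is nonempty. -/
theorem genericFibreDim_of_generic_point {k : Type*} [CommRing k] {m n : ℕ}
    {Γ Z : Set (RelAffineSpace (BaseRing k m) n)} (hZ : Z ⊆ Γ) {p₀ : PrimeSpectrum (BaseRing k m)}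
    (hΓ : projClosure Γ = closure {p₀}) {U : Set (PrimeSpectrum (BaseRing k m))} (hU : IsOpen U)
    (hp₀ : p₀ ∈ U) {s : ℕ}
    (h : ∀ p ∈ U ∩ closure {p₀}, topologicalKrullDim (fibreOver Z p) = s) :
    GenericFibreDim Z s ∧ projClosure Z = projClosure Γ := by
  have hp₀' : p₀ ∈ U ∩ closure {p₀} := ⟨hp₀, subset_closure rfl⟩
  have heq : projClosure Z = projClosure Γ := by
    refine subset_antisymm (closure_mono (Set.image_mono hZ)) ?_
    obtain ⟨P, hP, hP'⟩ := fibreOver_nonempty_of_dim_eq (h p₀ hp₀')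
    rw [hΓ]
    exact closure_mono (Set.singleton_subset_iff.mpr ⟨P, hP, hP'⟩)
  refine ⟨⟨U, hU, ?_, ?_⟩, heq⟩
  · rw [heq, hΓ]
    exact closure_mono (Set.singleton_subset_iff.mpr hp₀')
  · rwa [heq, hΓ]

theorem dim_fibreOver_generic_point {k : Type*} [CommRing k] {m n d : ℕ}
    {Γ : Set (RelAffineSpace (BaseRing k m) n)} {p₀ : PrimeSpectrum (BaseRing k m)}
    (hΓ : projClosure Γ = closure {p₀}) (h : GenericFibreDim Γ d) :
    topologicalKrullDim (fibreOver Γ p₀) = d := by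
  obtain ⟨U, hU, hdense, hdim⟩ := h
  rw [hΓ] at hdense hdim
  have hp₀ : p₀ ∈ closure {p₀} := subset_closure rfl
  obtain ⟨p, hpU, hp⟩ : (U ∩ closure {p₀}).Nonempty := closure_nonempty_iff.mp ⟨p₀, hdense hp₀⟩
  exact hdim p₀ ⟨(specializes_iff_mem_closure.mpr hp).mem_open hU hpU, hp₀⟩

/-- If the linear forms given by `M` are part of a family `y` as in Noether normalization,
then the sections by `M x = c` have fibres of dimension `s` over all points of the
projection closure outside the zero locus of some `b`, which does not vanish at its generic
point. -/
theorem exists_forall_dim_fibreOver_eq {k D A : Type*} [CommRing k] [CommRing D] [CommRing A]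
    {m n r s : ℕ} [Algebra (BaseRing k m) D] [Algebra (BaseRing k m) A] [Algebra D A]
    [IsScalarTower (BaseRing k m) D A] [FaithfulSMul D A]
    (hsurj : Surjective (algebraMap (BaseRing k m) D))
    (ψ : TotalRing k m n →ₐ[BaseRing k m] A) (hψ : Surjective ψ)
    (hgen : Algebra.adjoin D (Set.range fun j ↦ ψ (X j)) = ⊤)
    (M : Matrix (Fin r) (Fin n) k) (c : Fin r → k) (y : Fin r ⊕ Fin s → A)
    (hyM : ∀ i, y (Sum.inl i) = ∑ j, algebraMap (BaseRing k m) A (C (M i j)) * ψ (X j))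
    (hy : AlgebraicIndependent D y) (f : D) (hf0 : f ≠ 0)
    (hf : ∀ j, IsIntegral (Algebra.adjoin D (Set.range y)) (f • ψ (X j))) :
    ∃ b : BaseRing k m, C b ∉ RingHom.ker ψ ∧ ∀ p : PrimeSpectrum (BaseRing k m),
      (RingHom.ker ψ).comap C ≤ p.asIdeal → b ∉ p.asIdeal →
      topologicalKrullDim (fibreOver
        (PrimeSpectrum.zeroLocus (RingHom.ker ψ) ∩ timesBase m (linearLocus M c)) p) = s := by
  have hmk : ∀ b, algebraMap (BaseRing k m) D b = 0 ↔ C b ∈ RingHom.ker ψ := fun b ↦ by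
    rw [← FaithfulSMul.algebraMap_eq_zero_iff D A, ← IsScalarTower.algebraMap_apply,
      RingHom.mem_ker, ← ψ.commutes]
    rfl
  obtain ⟨b, rfl⟩ := hsurj f
  refine ⟨b, fun h ↦ hf0 ((hmk b).mpr h), fun p hp hbp ↦ ?_⟩
  let c' : Fin r → D := fun i ↦ algebraMap (BaseRing k m) _ (C (c i))
  simp_rw [algebraMap_smul] at hf
  have hdim := ringKrullDim_fiber_eq hsurj y hy _ hgen b hf c' p.asIdeal
    (fun a ha ↦ hp ((hmk a).mp ha)) hbp
  set J := Ideal.span (Set.range fun i ↦ y (Sum.inl i) - algebraMap D A (c' i)) with hJdef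
  let g : TotalRing k m n →ₐ[BaseRing k m] A ⧸ J := (Ideal.Quotient.mkₐ _ J).comp ψ
  have hg : Surjective g := Ideal.Quotient.mk_surjective.comp hψ
  rw [topologicalKrullDim_fibreOver g hg _ ?_ p, hdim, Nat.card_eq_fintype_card, Fintype.card_fin]
  have hJ : J = (Ideal.span (Set.range fun i : Fin r ↦
      (∑ j, C (C (M i j)) * X j) - C (C (c i)) : Set (TotalRing k m n))).map ψ := by
    rw [Ideal.map_span, ← Set.range_comp, hJdef]
    congr 2
    ext i
    have hC : ∀ a, ψ (C a) = algebraMap _ A a := ψ.commutes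
    simp only [comp_apply, hyM, map_sub, map_sum, map_mul, hC, c']
    rw [← IsScalarTower.algebraMap_apply]
  have hker : RingHom.ker g = Ideal.span (Set.range fun i : Fin r ↦
      (∑ j, C (C (M i j)) * X j) - C (C (c i)) : Set (TotalRing k m n)) ⊔ RingHom.ker ψ := by
    have h1 : RingHom.ker g = J.comap ψ := by
      ext a
      exact Ideal.Quotient.eq_zero_iff_mem
    rw [h1, hJ]
    exact Ideal.comap_map_of_surjective ψ hψ _
  ext P
  rw [Set.mem_inter_iff, mem_timesBase_linearLocus, hker, PrimeSpectrum.mem_zeroLocus,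
    PrimeSpectrum.mem_zeroLocus, SetLike.coe_subset_coe, SetLike.coe_subset_coe, sup_le_iff,
    Ideal.span_le, Set.range_subset_iff, and_comm]
  rfl

theorem adjoin_range_X_eq_top {B D A : Type*} [CommRing B] [CommRing D] [CommRing A] [Algebra B D]
    [Algebra B A] [Algebra D A] [IsScalarTower B D A] {κ : Type*} (ψ : MvPolynomial κ B →ₐ[B] A)
    (hψ : Surjective ψ) : Algebra.adjoin D (Set.range fun j ↦ ψ (X j)) = ⊤ := by
  rw [eq_top_iff]
  rintro a -
  obtain ⟨P, rfl⟩ := hψ a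
  induction P using MvPolynomial.induction_on with
  | C b =>
    have : ψ (C b) = algebraMap D A (algebraMap _ D b) := by
      rw [← IsScalarTower.algebraMap_apply]
      exact ψ.commutes b
    rw [this]
    exact Subalgebra.algebraMap_mem _ _
  | add P Q hP hQ => rw [map_add]; exact add_mem hP hQ
  | mul_X P j hP => rw [map_mul]; exact mul_mem hP (Algebra.subset_adjoin ⟨j, rfl⟩)

theorem exists_generic_linearLocus {k D A : Type*} [CommRing k] [IsDomain k] [Infinite k]
    [CommRing D] [IsDomain D] [CommRing A] [IsDomain A] {m n : ℕ} [Algebra (BaseRing k m) D]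
    [Algebra (BaseRing k m) A] [Algebra D A] [IsScalarTower (BaseRing k m) D A] [FaithfulSMul D A]
    [Algebra k D] [Algebra k A] [IsScalarTower k D A] [IsScalarTower k (BaseRing k m) A]
    [FaithfulSMul k D]
    (hsurj : Surjective (algebraMap (BaseRing k m) D))
    (ψ : TotalRing k m n →ₐ[BaseRing k m] A) (hψ : Surjective ψ) (r s : ℕ)
    (htr : Algebra.trdeg D A = (r + s : ℕ)) :
    ∃ q : MvPolynomial (Fin r × Fin n) k,
      (∃ M : Matrix (Fin r) (Fin n) k, RowsExtendToBasis M ∧ eval (fun ij ↦ M ij.1 ij.2) q ≠ 0) ∧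
      ∀ M : Matrix (Fin r) (Fin n) k, eval (fun ij ↦ M ij.1 ij.2) q ≠ 0 →
        LinearIndependent k M.row ∧ ∀ c : Fin r → k,
        ∃ b : BaseRing k m, C b ∉ RingHom.ker ψ ∧ ∀ p : PrimeSpectrum (BaseRing k m),
          (RingHom.ker ψ).comap C ≤ p.asIdeal → b ∉ p.asIdeal →
          topologicalKrullDim (fibreOver
            (PrimeSpectrum.zeroLocus (RingHom.ker ψ) ∩ timesBase m (linearLocus M c)) p) = s := by
  have hgen := adjoin_range_X_eq_top (D := D) ψ hψ
  obtain ⟨q, hq, hM⟩ := exists_generic_noether_normalization (k := k) _ hgen r s htr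
  refine ⟨q, hq, fun M hqM ↦ ?_⟩
  obtain ⟨y, hyM, hy, f, hf0, hf⟩ := hM M hqM
  refine ⟨?_, fun c ↦ exists_forall_dim_fibreOver_eq hsurj ψ hψ hgen M c y (fun i ↦ ?_) hy f hf0 hf⟩
  · rw [Fintype.linearIndependent_iff]
    intro l hl i
    have h1 := (hy.comp _ Sum.inl_injective).linearIndependent
    rw [Fintype.linearIndependent_iff] at h1
    have h2 := h1 (fun i ↦ algebraMap k D (l i)) ?_ i
    · rwa [FaithfulSMul.algebraMap_eq_zero_iff] at h2
    · have h3 : ∀ j, ∑ i, l i * M i j = 0 := fun j ↦ by simpa using congr($hl j)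
      have h4 : ∀ j, ∑ i, algebraMap k A (l i) * algebraMap k A (M i j) = 0 := fun j ↦ by
        simp_rw [← map_mul]
        rw [← map_sum, h3, map_zero]
      simp only [comp_apply, hyM, Algebra.smul_def, ← IsScalarTower.algebraMap_apply,
        Finset.mul_sum, ← mul_assoc]
      rw [Finset.sum_comm]
      simp_rw [← Finset.sum_mul, h4, zero_mul, Finset.sum_const_zero]
  · rw [hyM]
    refine Finset.sum_congr rfl fun j _ ↦ ?_
    rw [IsScalarTower.algebraMap_apply k (BaseRing k m) A]
    rfl

end

/-! ### Generic linear sections of an irreducible closed subset -/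

section

open Function MvPolynomial

theorem projClosure_zeroLocus {k : Type*} [CommRing k] {m n : ℕ}
    (η : RelAffineSpace (BaseRing k m) n) :
    projClosure (PrimeSpectrum.zeroLocus (η.asIdeal : Set (TotalRing k m n))) =
      closure {baseProj k m n η} := by
  have h1 : PrimeSpectrum.zeroLocus (η.asIdeal : Set (TotalRing k m n)) = closure {η} :=
    (PrimeSpectrum.closure_singleton η).symm
  have h2 : Continuous (baseProj k m n) := PrimeSpectrum.continuous_comap _
  rw [projClosure, h1, closure_image_closure h2, Set.image_singleton]

/-- The genericity statement for the closed subset given by a surjection of `B[x]` onto a domain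
`A`, where `D` is the image of `B` in `A`. -/
theorem exists_generic_section {k D A : Type*} [CommRing k] [IsDomain k] [Infinite k]
    [CommRing D] [IsDomain D] [CommRing A] [IsDomain A] {m n : ℕ} [Algebra (BaseRing k m) D]
    [Algebra (BaseRing k m) A] [Algebra D A] [IsScalarTower (BaseRing k m) D A] [FaithfulSMul D A]
    [Algebra k D] [Algebra k A] [IsScalarTower k D A] [IsScalarTower k (BaseRing k m) A]
    [FaithfulSMul k D]
    (hsurj : Surjective (algebraMap (BaseRing k m) D))
    (ψ : TotalRing k m n →ₐ[BaseRing k m] A) (hψ : Surjective ψ)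
    {Γ : Set (RelAffineSpace (BaseRing k m) n)}
    (hΓ : Γ = PrimeSpectrum.zeroLocus (RingHom.ker ψ)) {d d' : ℕ} (hd' : d' ≤ d)
    (hdim : GenericFibreDim Γ d) :
    ∃ q : MvPolynomial (Fin d' × Fin n) k,
      (∃ M : Matrix (Fin d') (Fin n) k,
        RowsExtendToBasis M ∧ eval (fun ij ↦ M ij.1 ij.2) q ≠ 0) ∧
      ∀ (M : Matrix (Fin d') (Fin n) k) (c : Fin d' → k), eval (fun ij ↦ M ij.1 ij.2) q ≠ 0 →
        LinearIndependent k M.row ∧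
        GenericFibreDim (Γ ∩ timesBase m (linearLocus M c)) (d - d') ∧
        projClosure (Γ ∩ timesBase m (linearLocus M c)) = projClosure Γ := by
  have hprime : (RingHom.ker ψ).IsPrime := RingHom.ker_isPrime ψ
  let η : RelAffineSpace (BaseRing k m) n := ⟨RingHom.ker ψ, hprime⟩
  have hcl : projClosure Γ = closure {baseProj k m n η} :=
    hΓ ▸ projClosure_zeroLocus η
  obtain ⟨e, he⟩ : ∃ e : ℕ, Algebra.trdeg D A = e := Cardinal.lt_aleph0.mp
    ((trdeg_le_of_adjoin_eq_top _ (adjoin_range_X_eq_top (D := D) ψ hψ)).trans_lt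
      (Cardinal.natCast_lt_aleph0))
  -- the fibre over the generic point has dimension `e`: apply the lemma with no equations at all
  obtain rfl : e = d := by
    obtain ⟨q, ⟨M, -, hM⟩, h⟩ := exists_generic_linearLocus hsurj ψ hψ 0 e (by rw [he, zero_add])
    obtain ⟨b, hb, hbdim⟩ := (h M hM).2 0
    have h1 := hbdim (baseProj k m n η) le_rfl hb
    have h2 : timesBase m (linearLocus M 0) = Set.univ := by
      ext P
      simp [mem_timesBase_linearLocus]
    rw [h2, Set.inter_univ, ← hΓ, dim_fibreOver_generic_point hcl hdim] at h1
    exact_mod_cast h1.symm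
  obtain ⟨q, hq, h⟩ := exists_generic_linearLocus hsurj ψ hψ d' (e - d')
    (by rw [he, Nat.add_sub_cancel' hd'])
  rw [← hΓ] at h
  refine ⟨q, hq, fun M c hM ↦ ⟨(h M hM).1, ?_⟩⟩
  obtain ⟨b, hb, hbdim⟩ := (h M hM).2 c
  refine genericFibreDim_of_generic_point Set.inter_subset_left hcl
    (U := PrimeSpectrum.basicOpen b) (PrimeSpectrum.basicOpen b).isOpen hb fun p hp ↦ ?_
  refine hbdim p ?_ hp.1
  exact (PrimeSpectrum.le_iff_mem_closure _ _).mpr hp.2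

end

theorem mainTheorem4 {k : Type*} [CommRing k] [IsDomain k] [Infinite k] (m n d : ℕ)
    (Γ : Set (RelAffineSpace (BaseRing k m) n)) (hclosed : IsClosed Γ) (hirr : IsIrreducible Γ)
    (hdim : GenericFibreDim Γ d)
    (hk : (PrimeSpectrum.vanishingIdeal Γ).comap (algebraMap k (TotalRing k m n)) = ⊥)
    (d' : ℕ) (hd' : d' ≤ d) :
    -- existence of a suitable affine subspace, constant along the fibres
    (∃ L' : Set (RelAffineSpace k n),
      IsAffineSubspace L' (n - d') ∧
      IsAffineSubspace (timesBase m L') (n - d') ∧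
      GenericFibreDim (Γ ∩ timesBase m L') (d - d') ∧
      projClosure (Γ ∩ timesBase m L') = projClosure Γ) ∧
    -- genericity: all equations `A x = c` with coefficients in a Zariski open set work,
    -- and the open set contains the equations of some affine subspace
    (∃ q : MvPolynomial ((Fin d' × Fin n) ⊕ Fin d') k,
      (∃ (A : Matrix (Fin d') (Fin n) k) (c : Fin d' → k), RowsExtendToBasis A ∧
        MvPolynomial.eval (Sum.elim (fun ij => A ij.1 ij.2) c) q ≠ 0) ∧
      ∀ (A : Matrix (Fin d') (Fin n) k) (c : Fin d' → k),
        MvPolynomial.eval (Sum.elim (fun ij => A ij.1 ij.2) c) q ≠ 0 →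
          LinearIndependent k A.row ∧
          GenericFibreDim (Γ ∩ timesBase m (linearLocus A c)) (d - d') ∧
          projClosure (Γ ∩ timesBase m (linearLocus A c)) = projClosure Γ) := by
  set I := PrimeSpectrum.vanishingIdeal Γ with hI
  have hprime : I.IsPrime := (PrimeSpectrum.isIrreducible_iff_vanishingIdeal_isPrime).mp hirr
  let ψ : TotalRing k m n →ₐ[BaseRing k m] TotalRing k m n ⧸ I := Ideal.Quotient.mkₐ _ I
  have hker : RingHom.ker ψ = I := Ideal.Quotient.mkₐ_ker (BaseRing k m) I
  have hΓ : Γ = PrimeSpectrum.zeroLocus (RingHom.ker ψ) := by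
    rw [hker, hI, PrimeSpectrum.zeroLocus_vanishingIdeal_eq_closure, hclosed.closure_eq]
  -- the image of `B` in `B[x] / I`, isomorphic to `B / (I ∩ B)`
  let D : Subalgebra (BaseRing k m) (TotalRing k m n ⧸ I) := ⊥
  have hsurj : Function.Surjective (algebraMap (BaseRing k m) D) := fun z ↦ by
    obtain ⟨b, hb⟩ := Algebra.mem_bot.mp z.2
    exact ⟨b, Subtype.ext hb⟩
  have hkD : FaithfulSMul k D := by
    rw [faithfulSMul_iff_algebraMap_injective, injective_iff_map_eq_zero]
    intro a ha
    have h0 : Ideal.Quotient.mk I (algebraMap k (TotalRing k m n) a) = 0 :=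
      congr(($ha : TotalRing k m n ⧸ I))
    have h1 : a ∈ I.comap (algebraMap k (TotalRing k m n)) :=
      Ideal.mem_comap.mpr (Ideal.Quotient.eq_zero_iff_mem.mp h0)
    rwa [hk] at h1
  obtain ⟨q, ⟨M, hMrows, hMq⟩, hq⟩ := exists_generic_section (k := k) hsurj ψ
    (Ideal.Quotient.mkₐ_surjective (BaseRing k m) I) hΓ hd' hdim
  refine ⟨⟨linearLocus M 0, ?_⟩, MvPolynomial.rename Sum.inl q, ⟨M, 0, hMrows, ?_⟩,
    fun A c hA ↦ hq A c ?_⟩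
  · have hn : n - d' + d' = n := by
      obtain ⟨-, -, f, -⟩ := hMrows
      have := Fintype.card_le_of_embedding f
      simp only [Fintype.card_fin] at this
      omega
    refine ⟨⟨d', hn, M, 0, hMrows, rfl⟩,
      ⟨d', hn, _, _, hMrows.map (MvPolynomial.C : k →+* BaseRing k m),
        timesBase_linearLocus m M 0⟩,
      (hq M 0 hMq).2⟩
  · rwa [MvPolynomial.eval_rename]
  · rwa [MvPolynomial.eval_rename] at hA
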